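/- Let $\diamond$ denote a hole. A partial permutation of length $n$ with $k$ holes is a word $\pi=\pi_1\cdots\pi_n$ over $\{1,\dots,n-k\}\cup\{\diamond\}$ in which each of $1,\dots,n-k$ appears exactly once and the remaining $k$ symbols are holes. The standardization $\mathrm{st}(w)$ of a word $w$ with distinct letters from a totally ordered set is obtained by replacing its $i$-th smallest letter by $i$, for each $i$. A permutation $\sigma$ of $\{1,\dots,n\}$, written as a word $\sigma_1\cdots\sigma_n$, is an extension of $\pi$ if $\mathrm{st}(\sigma_{i(1)}\cdots\sigma_{i(n-k)})=\pi_{i(1)}\cdots\pi_{i(n-k)}$, where $i(1)<\dots<i(n-k)$ are the positions of the non-holes of $\pi$. A permutation avoids a pattern $p$ (a permutation of $\{1,\dots,\ell\}$) if none of its subwords of length $\ell$ (on not necessarily consecutive positions) standardizes to $p$. A partial permutation avoids $p$ if each of its extensions avoids $p$. Let $s_n^k(p)$ be the number of partial permutations of length $n$ with $k$ holes that avoid $p$. Theorem. For every integer $n\ge 1$, $$s_n^1(1342)=\binom{2n-2}{n-1}-\binom{2n-2}{n-5},$$ where $\binom{m}{j}=0$ for $j<0$. -/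

import Mathlib

namespace PartialPerm

/-- The standardization of a word `w` with pairwise distinct letters: each letter is replaced
with its rank among the letters of `w`.  Ranks, like all symbols below, are counted from `0`,
so the alphabet `{1, ..., m}` is represented by `{0, ..., m - 1}`. -/
def st {ι α : Type*} [Fintype ι] [LinearOrder α] (w : ι → α) (i : ι) : ℕ :=
  (Finset.univ.filter fun j => w j < w i).card

/-- An occurrence of the pattern `p` in the permutation `σ`: a choice of positions
`f 0 < f 1 < ... < f (l - 1)` such that the corresponding subword of `σ` standardizes to `p`. -/
def IsOccurrence {l n : ℕ} (p : Equiv.Perm (Fin l)) (σ : Equiv.Perm (Fin n))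
    (f : Fin l → Fin n) : Prop :=
  StrictMono f ∧ ∀ a : Fin l, st (fun b => σ (f b)) a = (p a : ℕ)

/-- The permutation `σ` avoids the pattern `p`. -/
def PermAvoids {l n : ℕ} (σ : Equiv.Perm (Fin n)) (p : Equiv.Perm (Fin l)) : Prop :=
  ¬ ∃ f : Fin l → Fin n, IsOccurrence p σ f

/-- The set of partial permutations of length `n` with `k` holes: words of length `n` over
`n - k` symbols and the hole `none`, in which each symbol appears exactly once and there are
exactly `k` holes.  (The set is empty for `k > n`.) -/
def partialPerms (n k : ℕ) : Set (Fin n → Option (Fin (n - k))) :=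
  {π | (∀ v : Fin (n - k), ∃! i : Fin n, π i = some v) ∧
    (Finset.univ.filter fun i => π i = none).card = k}

/-- The permutation `σ` is an extension of the partial word `π`: the subword of `σ` on the
non-hole positions of `π` standardizes to the word formed by the non-hole symbols of `π`. -/
def IsExtension {n m : ℕ} (π : Fin n → Option (Fin m)) (σ : Equiv.Perm (Fin n)) : Prop :=
  ∀ (i : {i : Fin n // π i ≠ none}) (v : Fin m), π i = some v →
    st (fun j : {j : Fin n // π j ≠ none} => σ j) i = (v : ℕ)

/-- A partial permutation avoids `p` if each of its extensions avoids `p`. -/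
def Avoids {n m l : ℕ} (π : Fin n → Option (Fin m)) (p : Equiv.Perm (Fin l)) : Prop :=
  ∀ σ : Equiv.Perm (Fin n), IsExtension π σ → PermAvoids σ p

/-- `s n k p` is the number of partial permutations of length `n` with `k` holes
that avoid the pattern `p`. -/
noncomputable def s {l : ℕ} (n k : ℕ) (p : Equiv.Perm (Fin l)) : ℕ :=
  {π ∈ partialPerms n k | Avoids π p}.ncard

/-- The pattern `1342`, written with the symbols `0, 1, 2, 3` as `0231`. -/
def p1342 : Equiv.Perm (Fin 4) where
  toFun := ![0, 2, 3, 1]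
  invFun := ![0, 3, 1, 2]
  left_inv := by decide
  right_inv := by decide

/-- The binomial coefficient with an integer lower index; it is `0` if that index is negative. -/
def binom (m : ℕ) (k : ℤ) : ℤ :=
  if 0 ≤ k then (m.choose k.toNat : ℤ) else 0

end PartialPerm

/-!
A partial permutation with one hole is a permutation `τ` together with a place for the hole, and
its extensions are obtained by filling the hole with an arbitrary value.  Deleting one letter
from `1342` leaves `231`, `132`, `132` or `123`, and the place of the deleted letter is where the
hole sits; hence all fillings avoid `1342` exactly if there is no `123` to the left of the hole,
no `231` to its right, and no `132` across it (`forall_permAvoids_insertPerm_iff`).  A `1342`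
inside `τ` need not be excluded separately, since it contains one of these for every place of the
hole.

Such permutations are grown by insertion.  The part to the right of the hole is built by
appending letters, and then letters are put in front, one at a time.  In both phases the values
that may be inserted are those above some bound, and if there are `k` of them, then the words they
lead to have `2, 3, ..., k + 1` allowed values, in some order: this is the generating tree of the
Catalan numbers (`sum_backLabel_insertPerm`, `sum_frontLabel_insertPerm`).  If `C` is the Catalan
series, then `C ^ k = 1 + X (C ^ 2 + ... + C ^ (k + 1))`, so a node with `k` children has the
generating function `C ^ k` for its descendants.  Thus there are `catalan q` possible right parts
`β` of length `q`, and `β` contributes `X ^ q * C ^ k`, where `k` is the number of values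
that may be put in front of `β`.  Appending a new maximum to `β` increases this number by one,
and appending any other letter resets it to `2`; the series `T q` of the sums of `C ^ k` over all
`β` of length `q` therefore satisfies `T (q + 1) = C * T q + (catalan (q + 1) - catalan q) * C ^ 2`
(`extensionSeries_succ`).  Summing over `q` gives the generating function `C ^ 2 + X ^ 2 * C ^ 6`,
whose coefficients follow from those of the powers of `C` (`coeff_cat_pow`).
-/

namespace PartialPerm

/-! ### Powers of the Catalan series -/

section CatalanSeries

open Finset PowerSeries

/-- The Catalan generating function, over `ℤ`. -/
noncomputable def cat : PowerSeries ℤ := catalanSeries.map (Nat.castRingHom ℤ)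

theorem cat_eq : cat = 1 + X * cat ^ 2 := by
  have h := congrArg (PowerSeries.map (Nat.castRingHom ℤ)) catalanSeries_sq_mul_X_add_one
  simp only [map_add, map_mul, map_pow, map_one, PowerSeries.map_X] at h
  rw [cat]
  linear_combination -h

theorem constantCoeff_cat : constantCoeff cat = 1 := by
  rw [cat_eq]; simp

theorem coeff_zero_cat_pow (k : ℕ) : coeff 0 (cat ^ k) = 1 := by
  simp [constantCoeff_cat]

theorem coeff_succ_cat_pow (r k : ℕ) :
    coeff (r + 1) (cat ^ (k + 1)) = coeff (r + 1) (cat ^ k) + coeff r (cat ^ (k + 2)) := by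
  have h : cat ^ (k + 1) = cat ^ k + X * cat ^ (k + 2) := by
    have := cat_eq
    linear_combination cat ^ k * this
  rw [h, map_add, coeff_succ_X_mul]

/-- The coefficients of the powers of the Catalan series count the descents from a node with `k`
children in the Catalan generating tree, in which the children of such a node have
`2, 3, ..., k + 1` children. -/
theorem coeff_succ_cat_pow_eq_sum (r k : ℕ) :
    coeff (r + 1) (cat ^ k) = ∑ j ∈ Icc 2 (k + 1), coeff r (cat ^ j) := by
  induction k with
  | zero => simp [coeff_one]
  | succ k ih => rw [coeff_succ_cat_pow, ih, ← Finset.sum_Icc_succ_top (b := k + 1) (by omega)]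

/-- The coefficients of the powers of the Catalan series are the ballot numbers. -/
theorem coeff_cat_pow (r k : ℕ) :
    coeff (r + 1) (cat ^ k) =
      ((2 * r + k + 1).choose (r + 1) : ℤ) - (2 * r + k + 1).choose r := by
  induction r generalizing k with
  | zero =>
    induction k with
    | zero => simp [coeff_one]
    | succ k ih =>
      rw [coeff_succ_cat_pow, ih, coeff_zero_cat_pow]
      simp
  | succ r ih =>
    induction k with
    | zero =>
      have := Nat.choose_symm_of_eq_add (show 2 * (r + 1) + 0 + 1 = (r + 1 + 1) + (r + 1) by ring)
      rw [this]
      simp [coeff_one]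
    | succ k ihk =>
      rw [coeff_succ_cat_pow, ihk, ih]
      have e : 2 * (r + 1) + (k + 1) + 1 = (2 * r + k + 3) + 1 := by ring
      have e1 : 2 * (r + 1) + k + 1 = 2 * r + k + 3 := by ring
      have e2 : 2 * r + (k + 2) + 1 = 2 * r + k + 3 := by ring
      rw [e, e1, e2, Nat.choose_succ_succ' (2 * r + k + 3) (r + 1),
        Nat.choose_succ_succ' (2 * r + k + 3) r]
      push_cast
      ring

/-- The closed form: `C² + X² C⁶ = (1 - X⁴C⁸) / √(1 - 4X)`, compared coefficientwise. -/
theorem coeff_cat_sq_add (m : ℕ) :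
    coeff m (cat ^ 2 + X ^ 2 * cat ^ 6) =
      ((2 * m).choose m : ℤ) - if 4 ≤ m then ((2 * m).choose (m - 4) : ℤ) else 0 := by
  rw [map_add]
  match m with
  | 0 => simp [constantCoeff_cat]
  | 1 =>
    rw [coeff_cat_pow, coeff_X_pow_mul', if_neg (by norm_num)]
    decide
  | 2 =>
    rw [coeff_cat_pow, coeff_X_pow_mul', if_pos (by norm_num), coeff_zero_cat_pow]
    decide
  | 3 =>
    rw [coeff_cat_pow, coeff_X_pow_mul', if_pos (by norm_num), coeff_cat_pow]
    decide
  | m + 4 =>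
    rw [coeff_cat_pow, coeff_X_pow_mul', if_pos (by omega), if_pos (by omega),
      show m + 4 - 2 = (m + 1) + 1 by omega, coeff_cat_pow, show m + 4 - 4 = m by omega]
    have e1 : 2 * (m + 3) + 2 + 1 = (2 * m + 8) + 1 := by ring
    have e2 : 2 * (m + 1) + 6 + 1 = (2 * m + 8) + 1 := by ring
    rw [e1, e2, show 2 * (m + 4) = 2 * m + 8 by ring]
    simp only [Nat.choose_succ_succ']
    push_cast
    ring

/-- Summing `T q Xᵠ` when `T (q + 1) = C T q + (e (q + 1) - e q) C²` and `e` is the Catalan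
sequence. -/
theorem sum_coeff_of_recursion (T : ℕ → PowerSeries ℤ) (e : ℕ → ℤ) (he : ∀ q, e q = coeff q cat)
    (h0 : T 0 = cat) (h1 : ∀ q, T (q + 1) = cat * T q + (C (e (q + 1)) - C (e q)) * cat ^ 2)
    (m : ℕ) :
    ∑ q ∈ range (m + 1), coeff (m - q) (T q) = coeff m (cat ^ 2 + X ^ 2 * cat ^ 6) := by
  set U : ℕ → PowerSeries ℤ := fun m => ∑ q ∈ range (m + 1), X ^ q * T q with hU
  set E : ℕ → PowerSeries ℤ := fun m => ∑ q ∈ range (m + 1), X ^ q * C (e q) with hE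
  have hcat := cat_eq
  have key : ∀ m, (1 - X * cat) * U m =
      cat + cat ^ 2 * (E m - 1 - X * E m) + X ^ (m + 1) * (C (e m) * cat ^ 2 - cat * T m) := by
    intro m
    induction m with
    | zero =>
      have : e 0 = 1 := by rw [he]; simpa using constantCoeff_cat
      simp [hU, hE, h0, this]
      ring
    | succ m ih =>
      have hU' : U (m + 1) = U m + X ^ (m + 1) * T (m + 1) := by simp [hU, sum_range_succ]
      have hE' : E (m + 1) = E m + X ^ (m + 1) * C (e (m + 1)) := by simp [hE, sum_range_succ]
      rw [hU', hE', mul_add, ih, h1]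
      ring
  have hE1 : (X : PowerSeries ℤ) ^ (m + 1) ∣ E m - cat := by
    rw [X_pow_dvd_iff]
    intro i hi
    simp only [hE, map_sub, map_sum, coeff_mul_C, coeff_X_pow, ite_mul, one_mul, zero_mul]
    rw [Finset.sum_ite_eq, if_pos (mem_range.2 hi), he, sub_self]
  obtain ⟨R, hR⟩ := hE1
  have hinv : cat * (1 - X * cat) = 1 := by linear_combination hcat
  have hfin : U m = cat ^ 2 + X ^ 2 * cat ^ 6 + X ^ (m + 1) *
      (cat ^ 3 * (1 - X) * R + C (e m) * cat ^ 3 - cat ^ 2 * T m) := by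
    have hEm : E m = cat + X ^ (m + 1) * R := by linear_combination hR
    have := key m
    rw [hEm] at this
    have h2 : cat ^ 2 + X ^ 2 * cat ^ 6 = cat * (cat + cat ^ 2 * (cat - 1 - X * cat)) := by
      have h3 : cat - 1 - X * cat = X ^ 2 * cat ^ 3 := by
        linear_combination (1 + X * cat) * hcat
      rw [h3]; ring
    rw [h2]
    linear_combination cat * this - U m * hinv
  have : coeff m (U m) = coeff m (cat ^ 2 + X ^ 2 * cat ^ 6) := by
    rw [hfin, map_add, coeff_X_pow_mul', if_neg (by omega), add_zero]
  rw [← this]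
  simp only [hU, map_sum]
  refine sum_congr rfl fun q hq => ?_
  rw [coeff_X_pow_mul', if_pos (by simpa [Nat.lt_succ_iff] using hq)]

end CatalanSeries

open Finset Equiv

/-! ### Insertion into permutations -/

section Insertion

variable {n : ℕ}

/-- Insertion of a new position `p` carrying the new value `v` into the permutation `τ`:
the old positions at or after `p` and the old values at or above `v` move up by one. -/
def insertPerm (p v : Fin (n + 1)) (τ : Perm (Fin n)) : Perm (Fin (n + 1)) :=
  (finSuccEquiv' p).trans ((optionCongr τ).trans (finSuccEquiv' v).symm)

@[simp]
theorem insertPerm_self (p v : Fin (n + 1)) (τ : Perm (Fin n)) : insertPerm p v τ p = v := by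
  simp [insertPerm]

@[simp]
theorem insertPerm_succAbove (p v : Fin (n + 1)) (τ : Perm (Fin n)) (i : Fin n) :
    insertPerm p v τ (p.succAbove i) = v.succAbove (τ i) := by
  simp [insertPerm]

@[simp]
theorem insertPerm_zero_succ (v : Fin (n + 1)) (τ : Perm (Fin n)) (i : Fin n) :
    insertPerm 0 v τ i.succ = v.succAbove (τ i) := by
  simpa using insertPerm_succAbove 0 v τ i

@[simp]
theorem insertPerm_last_castSucc (v : Fin (n + 1)) (τ : Perm (Fin n)) (i : Fin n) :
    insertPerm (Fin.last n) v τ i.castSucc = v.succAbove (τ i) := by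
  simpa using insertPerm_succAbove (Fin.last n) v τ i

theorem insertPerm_bijective (p : Fin (n + 1)) :
    Function.Bijective fun x : Fin (n + 1) × Perm (Fin n) => insertPerm p x.1 x.2 := by
  rw [Fintype.bijective_iff_injective_and_card]
  constructor
  · rintro ⟨v, τ⟩ ⟨v', τ'⟩ h
    have hv : v = v' := by simpa using congrArg (fun σ : Perm (Fin (n + 1)) => σ p) h
    subst hv
    have : τ = τ' := by
      ext1 i
      simpa using congrArg (fun σ : Perm (Fin (n + 1)) => σ (p.succAbove i)) h
    rw [this]
  · simp [Fintype.card_perm, Nat.factorial_succ]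

theorem sum_insertPerm {M : Type*} [AddCommMonoid M] (p : Fin (n + 1))
    (f : Perm (Fin (n + 1)) → M) :
    ∑ σ, f σ = ∑ τ : Perm (Fin n), ∑ v : Fin (n + 1), f (insertPerm p v τ) := by
  rw [← (insertPerm_bijective p).sum_comp, Fintype.sum_prod_type, sum_comm]

theorem val_succAbove (v : Fin (n + 1)) (x : Fin n) :
    (v.succAbove x : ℕ) = if (x : ℕ) < v then (x : ℕ) else x + 1 := by
  simp only [Fin.succAbove, Fin.lt_def, Fin.val_castSucc]
  split_ifs <;> simp

theorem lt_succAbove_iff_val (v : Fin (n + 1)) (x : Fin n) :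
    v < v.succAbove x ↔ (v : ℕ) ≤ x := by
  rw [Fin.lt_succAbove_iff_le_castSucc, Fin.le_def, Fin.val_castSucc]

theorem succAbove_lt_iff_val (v : Fin (n + 1)) (x : Fin n) :
    v.succAbove x < v ↔ (x : ℕ) < v := by
  rw [Fin.succAbove_lt_iff_castSucc_lt, Fin.lt_def, Fin.val_castSucc]

end Insertion

/-! ### Forbidden patterns around the hole -/

section Conditions

variable {n : ℕ}

/-- The permutation `τ`, with a hole between its first `p` entries and the remaining ones, has
no `123` to the left of the hole, no `231` to its right, and no `132` across it.  By
`forall_permAvoids_insertPerm_iff` this says that no filling of the hole contains `1342`. -/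
def HoleAvoids (p : ℕ) (τ : Perm (Fin n)) : Prop :=
  ∀ i j k : Fin n, i < j → j < k →
    ((k : ℕ) < p → ¬(τ i < τ j ∧ τ j < τ k)) ∧
    (p ≤ (i : ℕ) → ¬(τ k < τ i ∧ τ i < τ j)) ∧
    ((i : ℕ) < p → p ≤ (k : ℕ) → ¬(τ i < τ k ∧ τ k < τ j))

/-- The value `v` may be inserted in front of `τ`, the hole being behind the first `p` entries
of `τ`, without completing a forbidden pattern. -/
def AllowsFront (p : ℕ) (τ : Perm (Fin n)) (v : ℕ) : Prop :=
  ∀ j k : Fin n, j < k →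
    ((k : ℕ) < p → ¬(v ≤ (τ j : ℕ) ∧ τ j < τ k)) ∧
    (p ≤ (k : ℕ) → ¬(v ≤ (τ k : ℕ) ∧ τ k < τ j))

/-- The value `v` may be appended to `τ` without completing a `231`. -/
def AllowsBack (τ : Perm (Fin n)) (v : ℕ) : Prop :=
  ∀ i j : Fin n, i < j → ¬(v ≤ (τ i : ℕ) ∧ τ i < τ j)

theorem holeAvoids_insertPerm_zero (p : ℕ) (v : Fin (n + 1)) (τ : Perm (Fin n)) :
    HoleAvoids (p + 1) (insertPerm 0 v τ) ↔ HoleAvoids p τ ∧ AllowsFront p τ v := by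
  simp only [HoleAvoids, AllowsFront, Fin.forall_fin_succ, insertPerm_self, insertPerm_zero_succ,
    Fin.succAbove_lt_succAbove_iff, lt_succAbove_iff_val, succAbove_lt_iff_val,
    Fin.succ_lt_succ_iff, Fin.val_succ, Fin.val_zero, lt_irrefl, Fin.not_lt_zero, Fin.succ_pos]
  simp only [add_lt_add_iff_right, add_le_add_iff_right]
  simp
  tauto

theorem holeAvoids_insertPerm_last (v : Fin (n + 1)) (τ : Perm (Fin n)) :
    HoleAvoids 0 (insertPerm (Fin.last n) v τ) ↔ HoleAvoids 0 τ ∧ AllowsBack τ v := by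
  simp only [HoleAvoids, AllowsBack, Fin.forall_fin_succ', insertPerm_self,
    insertPerm_last_castSucc,
    Fin.succAbove_lt_succAbove_iff, lt_succAbove_iff_val, succAbove_lt_iff_val,
    Fin.castSucc_lt_castSucc_iff, lt_irrefl, Fin.castSucc_lt_last, Fin.val_castSucc]
  have h (x : Fin n) : ¬ Fin.last n < x.castSucc := not_lt.2 (Fin.castSucc_lt_last x).le
  simp [h]
  simp [forall_and]

theorem AllowsFront.mono {p : ℕ} {τ : Perm (Fin n)} {v w : ℕ} (h : AllowsFront p τ v)
    (hvw : v ≤ w) : AllowsFront p τ w := fun j k hjk =>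
  ⟨fun hk hh => (h j k hjk).1 hk ⟨hvw.trans hh.1, hh.2⟩,
    fun hk hh => (h j k hjk).2 hk ⟨hvw.trans hh.1, hh.2⟩⟩

theorem AllowsBack.mono {τ : Perm (Fin n)} {v w : ℕ} (h : AllowsBack τ v)
    (hvw : v ≤ w) : AllowsBack τ w := fun i j hij hh => h i j hij ⟨hvw.trans hh.1, hh.2⟩

theorem allowsFront_self (p : ℕ) (τ : Perm (Fin n)) : AllowsFront p τ n := fun j k _ =>
  ⟨fun _ hh => absurd hh.1 (not_le.2 (τ j).isLt), fun _ hh => absurd hh.1 (not_le.2 (τ k).isLt)⟩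

theorem allowsBack_self (τ : Perm (Fin n)) : AllowsBack τ n := fun i _ _ hh =>
  absurd hh.1 (not_le.2 (τ i).isLt)

/-- The least value that may be inserted in front of `τ`. -/
noncomputable def frontBound (p : ℕ) (τ : Perm (Fin n)) : ℕ := sInf {v | AllowsFront p τ v}

/-- The least value that may be appended to `τ`. -/
noncomputable def backBound (τ : Perm (Fin n)) : ℕ := sInf {v | AllowsBack τ v}

theorem allowsFront_iff {p : ℕ} {τ : Perm (Fin n)} {v : ℕ} :
    AllowsFront p τ v ↔ frontBound p τ ≤ v :=
  ⟨fun h => Nat.sInf_le h, fun h => AllowsFront.mono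
    (Nat.sInf_mem (s := {v | AllowsFront p τ v}) ⟨n, allowsFront_self p τ⟩) h⟩

theorem allowsBack_iff {τ : Perm (Fin n)} {v : ℕ} : AllowsBack τ v ↔ backBound τ ≤ v :=
  ⟨fun h => Nat.sInf_le h, fun h => AllowsBack.mono
    (Nat.sInf_mem (s := {v | AllowsBack τ v}) ⟨n, allowsBack_self τ⟩) h⟩

theorem frontBound_le (p : ℕ) (τ : Perm (Fin n)) : frontBound p τ ≤ n :=
  allowsFront_iff.1 (allowsFront_self p τ)

theorem backBound_le (τ : Perm (Fin n)) : backBound τ ≤ n :=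
  allowsBack_iff.1 (allowsBack_self τ)

theorem frontBound_eq {p : ℕ} {τ : Perm (Fin n)} {t : ℕ} (h : ∀ v, AllowsFront p τ v ↔ t ≤ v) :
    frontBound p τ = t :=
  le_antisymm (allowsFront_iff.1 ((h t).2 le_rfl)) ((h _).1 (allowsFront_iff.2 le_rfl))

theorem backBound_eq {τ : Perm (Fin n)} {t : ℕ} (h : ∀ v, AllowsBack τ v ↔ t ≤ v) :
    backBound τ = t :=
  le_antisymm (allowsBack_iff.1 ((h t).2 le_rfl)) ((h _).1 (allowsBack_iff.2 le_rfl))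

end Conditions

/-! ### The bounds under insertion -/

section Bounds

variable {n : ℕ}

/-- The number of values that may be inserted in front of `τ`. -/
noncomputable def frontLabel (p : ℕ) (τ : Perm (Fin n)) : ℕ := n + 1 - frontBound p τ

/-- The number of values that may be appended to `τ`. -/
noncomputable def backLabel (τ : Perm (Fin n)) : ℕ := n + 1 - backBound τ

theorem exists_val_eq (τ : Perm (Fin n)) {x : ℕ} (hx : x < n) : ∃ i, (τ i : ℕ) = x :=
  ⟨τ.symm ⟨x, hx⟩, by simp⟩

/-- Above the bound `frontBound p τ`, all values to the left of the hole are smaller than all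
values to its right; `a` separates the two. -/
theorem exists_separator (p : ℕ) (τ : Perm (Fin n)) :
    ∃ a, frontBound p τ ≤ a ∧ a ≤ n ∧
      ∀ i, frontBound p τ ≤ τ i → ((τ i : ℕ) < a ↔ (i : ℕ) < p) := by
  refine ⟨max (frontBound p τ) ((univ.filter fun i : Fin n => (i : ℕ) < p).sup
    fun i => (τ i : ℕ) + 1), le_max_left _ _, max_le (frontBound_le p τ) ?_, fun i hi => ?_⟩
  · exact Finset.sup_le fun i _ => (τ i).isLt
  · rw [lt_max_iff, Finset.lt_sup_iff]
    constructor
    · rintro (h | ⟨j, hj, hij⟩)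
      · omega
      · by_contra hip
        have hj' : (j : ℕ) < p := by simpa using hj
        have hne : i ≠ j := by rintro rfl; exact hip hj'
        have hval : (τ i : ℕ) ≠ τ j := fun h => hne (τ.injective (Fin.ext h))
        refine ((allowsFront_iff.2 le_rfl) j i (Fin.lt_def.2 (by omega))).2 (by omega)
          ⟨hi, Fin.lt_def.2 (by omega)⟩
    · exact fun h => Or.inr ⟨i, by simpa using h, by omega⟩

theorem allowsFront_insertPerm_zero (p : ℕ) (v : Fin (n + 1)) (τ : Perm (Fin n)) (w : ℕ) :
    AllowsFront (p + 1) (insertPerm 0 v τ) w ↔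
      (∀ k : Fin n, ((k : ℕ) < p → ¬(w ≤ v ∧ (v : ℕ) ≤ τ k)) ∧
        (p ≤ k → ¬(w ≤ τ k ∧ (τ k : ℕ) < v))) ∧
      ∀ j k : Fin n, j < k →
        ((k : ℕ) < p → ¬(w ≤ (v.succAbove (τ j) : ℕ) ∧ τ j < τ k)) ∧
        (p ≤ k → ¬(w ≤ (v.succAbove (τ k) : ℕ) ∧ τ k < τ j)) := by
  have h (k : Fin n) : (w ≤ (v.succAbove (τ k) : ℕ) ∧ (τ k : ℕ) < v) ↔
      (w ≤ τ k ∧ (τ k : ℕ) < v) := by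
    rw [val_succAbove]; split_ifs <;> simp [*]
  simp only [AllowsFront, Fin.forall_fin_succ, insertPerm_self, insertPerm_zero_succ,
    Fin.succAbove_lt_succAbove_iff, lt_succAbove_iff_val, succAbove_lt_iff_val,
    Fin.succ_lt_succ_iff, Fin.val_succ, Fin.val_zero, Fin.not_lt_zero, Fin.succ_pos, h,
    add_lt_add_iff_right, add_le_add_iff_right, forall_const, IsEmpty.forall_iff, true_and]

/-- The effect on `frontBound` of inserting an allowed value `v` in front of `τ`, where `a` is a
separator as in `exists_separator`. -/
theorem frontBound_insertPerm_zero {p : ℕ} {τ : Perm (Fin n)} {a : ℕ} (v : Fin (n + 1))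
    (h1 : frontBound p τ ≤ a) (h2 : a ≤ n)
    (h3 : ∀ i, frontBound p τ ≤ τ i → ((τ i : ℕ) < a ↔ (i : ℕ) < p))
    (hv : frontBound p τ ≤ v) :
    frontBound (p + 1) (insertPerm 0 v τ) =
      if (v : ℕ) < a then (v : ℕ) + 1 else if (v : ℕ) = a then frontBound p τ else v := by
  set T := frontBound p τ with hT
  have hT' : AllowsFront p τ T := allowsFront_iff.2 le_rfl
  have hge (x : Fin n) (h : T ≤ (v.succAbove x : ℕ)) : T ≤ x := by
    rw [val_succAbove] at h; split_ifs at h <;> omega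
  have hle (x : Fin n) : (x : ℕ) ≤ v.succAbove x := by
    rw [val_succAbove]; split_ifs <;> omega
  -- pairs of old entries never obstruct a value from `T` on
  have hold (w : ℕ) (hw : T ≤ w) (j k : Fin n) (hjk : j < k) :
      ((k : ℕ) < p → ¬(w ≤ (v.succAbove (τ j) : ℕ) ∧ τ j < τ k)) ∧
        (p ≤ k → ¬(w ≤ (v.succAbove (τ k) : ℕ) ∧ τ k < τ j)) :=
    ⟨fun hk hh => (hT' j k hjk).1 hk ⟨hge _ (hw.trans hh.1), hh.2⟩,
      fun hk hh => (hT' j k hjk).2 hk ⟨hge _ (hw.trans hh.1), hh.2⟩⟩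
  have hvn : (v : ℕ) ≤ n := Nat.lt_succ_iff.1 v.isLt
  apply frontBound_eq
  intro w
  rw [allowsFront_insertPerm_zero]
  split_ifs with c1 c2
  · constructor
    · rintro ⟨hw, -⟩
      obtain ⟨i, hi⟩ := exists_val_eq τ (show a - 1 < n by omega)
      have := (hw i).1 ((h3 i (by omega)).1 (by omega))
      omega
    · refine fun hw => ⟨fun k => ⟨fun _ => by omega, fun _ => by omega⟩, hold w (by omega)⟩
  · constructor
    · rintro ⟨-, hw⟩
      rw [hT, ← allowsFront_iff]
      exact fun j k hjk => ⟨fun hk hh => (hw j k hjk).1 hk ⟨hh.1.trans (hle _), hh.2⟩,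
        fun hk hh => (hw j k hjk).2 hk ⟨hh.1.trans (hle _), hh.2⟩⟩
    · refine fun hw => ⟨fun k => ⟨fun hk hh => ?_, fun hk hh => ?_⟩, hold w hw⟩
      · have := (h3 k (by omega)).2 hk
        omega
      · have := (h3 k (by omega)).1 (by omega)
        omega
  · constructor
    · rintro ⟨hw, -⟩
      obtain ⟨i, hi⟩ := exists_val_eq τ (show (v : ℕ) - 1 < n by omega)
      have h4 := h3 i (by omega)
      have := (hw i).2 (by omega)
      omega
    · refine fun hw => ⟨fun k => ⟨fun hk hh => ?_, fun hk hh => ?_⟩, hold w (by omega)⟩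
      · have := (h3 k (by omega)).2 hk
        omega
      · omega

theorem allowsBack_insertPerm_last (v : Fin (n + 1)) (τ : Perm (Fin n)) (w : ℕ) :
    AllowsBack (insertPerm (Fin.last n) v τ) w ↔
      (∀ i, ¬(w ≤ (v.succAbove (τ i) : ℕ) ∧ (τ i : ℕ) < v)) ∧
      ∀ i j : Fin n, i < j → ¬(w ≤ (v.succAbove (τ i) : ℕ) ∧ τ i < τ j) := by
  have h (x : Fin n) : ¬ Fin.last n < x.castSucc := not_lt.2 (Fin.castSucc_lt_last x).le
  simp only [AllowsBack, Fin.forall_fin_succ', insertPerm_self,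
    insertPerm_last_castSucc, h,
    Fin.succAbove_lt_succAbove_iff, lt_succAbove_iff_val, succAbove_lt_iff_val,
    Fin.castSucc_lt_castSucc_iff, lt_irrefl, Fin.castSucc_lt_last, forall_const,
    IsEmpty.forall_iff, implies_true, and_true, forall_and]
  exact and_comm

theorem backBound_insertPerm_last {τ : Perm (Fin n)} (v : Fin (n + 1)) (hv : AllowsBack τ v) :
    backBound (insertPerm (Fin.last n) v τ) = v := by
  apply backBound_eq
  intro w
  rw [allowsBack_insertPerm_last]
  have hvn : (v : ℕ) ≤ n := Nat.lt_succ_iff.1 v.isLt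
  constructor
  · rintro ⟨hw, -⟩
    by_contra hlt
    obtain ⟨i, hi⟩ := exists_val_eq τ (show (v : ℕ) - 1 < n by omega)
    have := hw i
    rw [val_succAbove, if_pos (by omega)] at this
    omega
  · refine fun hw => ⟨fun i => ?_, fun i j hij hh => hv i j hij ⟨?_, hh.2⟩⟩
    · rw [val_succAbove]; split_ifs <;> omega
    · have := hh.1
      rw [val_succAbove] at this
      split_ifs at this <;> omega

theorem allowsFront_insertPerm_last (v : Fin (n + 1)) (τ : Perm (Fin n)) (w : ℕ) :
    AllowsFront 0 (insertPerm (Fin.last n) v τ) w ↔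
      (∀ j, ¬(w ≤ v ∧ (v : ℕ) ≤ τ j)) ∧
      ∀ j k : Fin n, j < k → ¬(w ≤ (v.succAbove (τ k) : ℕ) ∧ τ k < τ j) := by
  have h (x : Fin n) : ¬ Fin.last n < x.castSucc := not_lt.2 (Fin.castSucc_lt_last x).le
  simp only [AllowsFront, Fin.forall_fin_succ', insertPerm_self,
    insertPerm_last_castSucc, h,
    Fin.succAbove_lt_succAbove_iff, lt_succAbove_iff_val, succAbove_lt_iff_val,
    Fin.castSucc_lt_castSucc_iff, lt_irrefl, Fin.castSucc_lt_last, forall_const,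
    IsEmpty.forall_iff, implies_true, and_true, forall_and, Nat.not_lt_zero, zero_le, true_and]
  exact and_comm

theorem frontBound_insertPerm_last_last (τ : Perm (Fin n)) :
    frontBound 0 (insertPerm (Fin.last n) (Fin.last n) τ) = frontBound 0 τ := by
  apply frontBound_eq
  intro w
  rw [allowsFront_insertPerm_last, ← allowsFront_iff]
  simp only [Fin.succAbove_last, Fin.val_castSucc, Fin.val_last, AllowsFront, Nat.not_lt_zero,
    IsEmpty.forall_iff, zero_le, forall_const, true_and]
  refine and_iff_right fun j hh => absurd hh.2 (not_le.2 (τ j).isLt)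

theorem frontBound_insertPerm_last_of_lt {τ : Perm (Fin n)} (v : Fin (n + 1))
    (hv : AllowsBack τ v) (hvn : (v : ℕ) < n) :
    frontBound 0 (insertPerm (Fin.last n) v τ) = n := by
  apply frontBound_eq
  intro w
  rw [allowsFront_insertPerm_last]
  constructor
  · rintro ⟨hw1, hw2⟩
    by_contra hlt
    obtain ⟨j, hj⟩ := exists_val_eq τ (show n - 1 < n by omega)
    by_cases hv1 : (v : ℕ) = n - 1
    · exact hw1 j (by omega)
    · -- the two largest old values must be inverted, for otherwise `v` would complete a `231`
      obtain ⟨i, hi⟩ := exists_val_eq τ (show n - 2 < n by omega)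
      have hlt' : τ i < τ j := Fin.lt_def.2 (by omega)
      rcases lt_trichotomy i j with hij | hij | hij
      · exact hv i j hij ⟨by omega, hlt'⟩
      · rw [hij] at hlt'; exact lt_irrefl _ hlt'
      · refine hw2 j i hij ⟨?_, hlt'⟩
        rw [val_succAbove]; split_ifs <;> omega
  · refine fun hw => ⟨fun j => by omega, fun j k hjk hh => ?_⟩
    have h1 := hh.1
    have h2 := Fin.lt_def.1 hh.2
    have h3 := (τ j).isLt
    rw [val_succAbove] at h1
    split_ifs at h1 <;> omega

end Bounds

/-! ### Counting with generating trees -/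

section Counting

open Classical PowerSeries

variable {n : ℕ} {M : Type*} [AddCommMonoid M]

theorem sum_fin_of_le (T : ℕ) (f : ℕ → M) :
    ∑ v : Fin (n + 1), (if T ≤ (v : ℕ) then f v else 0) = ∑ v ∈ Icc T n, f v := by
  rw [Fin.sum_univ_eq_sum_range (fun v => if T ≤ v then f v else 0), ← sum_filter]
  congr 1
  ext v
  simp
  omega

/-- Inserting the `k` allowed values in front of `τ` yields words with `2, 3, ..., k + 1` allowed
values, each number occurring once. -/
theorem sum_frontLabel_insertPerm (p : ℕ) (τ : Perm (Fin n)) (g : ℕ → M) :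
    ∑ v : Fin (n + 1), (if AllowsFront p τ v then
        g (frontLabel (p + 1) (insertPerm 0 v τ)) else 0) =
      ∑ j ∈ Icc 2 (frontLabel p τ + 1), g j := by
  obtain ⟨a, h1, h2, h3⟩ := exists_separator p τ
  have hT := frontBound_le p τ
  have hterm (v : Fin (n + 1)) : (if AllowsFront p τ v then
        g (frontLabel (p + 1) (insertPerm 0 v τ)) else 0) =
      if frontBound p τ ≤ (v : ℕ) then g (n + 1 + 1 - if (v : ℕ) < a then (v : ℕ) + 1 else
        if (v : ℕ) = a then frontBound p τ else v) else 0 := by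
    rw [allowsFront_iff]
    split_ifs with hv
    all_goals first
      | rfl
      | (rw [frontLabel, frontBound_insertPerm_zero v h1 h2 h3 hv]; simp [*])
  rw [sum_congr rfl fun v _ => hterm v, sum_fin_of_le (frontBound p τ) (fun v => g (n + 1 + 1 -
    if v < a then v + 1 else if v = a then frontBound p τ else v)), frontLabel]
  generalize frontBound p τ = T at *
  refine sum_bij' (fun v _ => n + 1 + 1 - if v < a then v + 1 else if v = a then T else v)
    (fun j _ => if n + 2 - j = T then a else if n + 2 - j ≤ a then n + 2 - j - 1 else n + 2 - j)
    ?_ ?_ ?_ ?_ fun _ _ => rfl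
  all_goals
    intro x hx
    rw [mem_Icc] at hx
    try rw [mem_Icc]
    grind

theorem sum_holeAvoids_succ (p : ℕ) (g : ℕ → M) :
    ∑ σ : Perm (Fin (n + 1)), (if HoleAvoids (p + 1) σ then g (frontLabel (p + 1) σ) else 0) =
      ∑ τ : Perm (Fin n), if HoleAvoids p τ then
        ∑ j ∈ Icc 2 (frontLabel p τ + 1), g j else 0 := by
  rw [sum_insertPerm 0]
  refine sum_congr rfl fun τ _ => ?_
  simp only [holeAvoids_insertPerm_zero]
  split_ifs with h
  · simp only [h, true_and, sum_frontLabel_insertPerm]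
  · simp [h]

/-- The generating tree of the insertions in front, followed down `p` levels; the weight
`coeff r (cat ^ k)` accounts for `r` further insertions into a word with `k` allowed values. -/
theorem sum_coeff_frontLabel (q p r : ℕ) :
    ∑ σ : Perm (Fin (q + p)), (if HoleAvoids p σ then coeff r (cat ^ frontLabel p σ) else 0) =
      ∑ τ : Perm (Fin q), if HoleAvoids 0 τ then coeff (r + p) (cat ^ frontLabel 0 τ) else 0 := by
  induction p generalizing r with
  | zero => rfl
  | succ p ih =>
    refine (sum_holeAvoids_succ (n := q + p) p fun k => coeff r (cat ^ k)).trans ?_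
    simp only [← coeff_succ_cat_pow_eq_sum]
    rw [ih, add_right_comm, add_assoc]

theorem sum_backLabel_insertPerm (τ : Perm (Fin n)) (g : ℕ → M) :
    ∑ v : Fin (n + 1), (if AllowsBack τ v then
        g (backLabel (insertPerm (Fin.last n) v τ)) else 0) =
      ∑ j ∈ Icc 2 (backLabel τ + 1), g j := by
  have hT := backBound_le τ
  have hterm (v : Fin (n + 1)) : (if AllowsBack τ v then
        g (backLabel (insertPerm (Fin.last n) v τ)) else 0) =
      if backBound τ ≤ (v : ℕ) then g (n + 1 + 1 - v) else 0 := by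
    rw [allowsBack_iff]
    split_ifs with hv
    · rw [backLabel, backBound_insertPerm_last v (allowsBack_iff.2 hv)]
    · rfl
  rw [sum_congr rfl fun v _ => hterm v, sum_fin_of_le (backBound τ) (fun v => g (n + 1 + 1 - v)),
    backLabel]
  refine sum_bij' (fun v _ => n + 1 + 1 - v) (fun j _ => n + 2 - j) ?_ ?_ ?_ ?_ fun _ _ => rfl
  all_goals
    intro x hx
    rw [mem_Icc] at hx
    try rw [mem_Icc]
    omega

theorem sum_coeff_backLabel (q r : ℕ) :
    ∑ τ : Perm (Fin q), (if HoleAvoids 0 τ then coeff r (cat ^ backLabel τ) else 0) =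
      coeff (r + q) cat := by
  induction q generalizing r with
  | zero =>
    have h (τ : Perm (Fin 0)) : backLabel τ = 1 := by
      have := backBound_le τ
      rw [backLabel]; omega
    simp [h, HoleAvoids]
  | succ q ih =>
    rw [sum_insertPerm (Fin.last q)]
    have hterm (τ : Perm (Fin q)) : ∑ v : Fin (q + 1),
        (if HoleAvoids 0 (insertPerm (Fin.last q) v τ) then
          coeff r (cat ^ backLabel (insertPerm (Fin.last q) v τ)) else 0) =
        if HoleAvoids 0 τ then coeff (r + 1) (cat ^ backLabel τ) else 0 := by
      simp only [holeAvoids_insertPerm_last]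
      split_ifs with h
      · simp only [h, true_and, coeff_succ_cat_pow_eq_sum]
        exact sum_backLabel_insertPerm τ fun k => coeff r (cat ^ k)
      · simp [h]
    rw [sum_congr rfl fun τ _ => hterm τ, ih]
    congr 2
    ring

/-- The generating function for the ways to extend the `231`-avoiding permutations of length `q`
to the left of the hole. -/
noncomputable def extensionSeries (q : ℕ) : PowerSeries ℤ :=
  ∑ τ : Perm (Fin q), if HoleAvoids 0 τ then cat ^ frontLabel 0 τ else 0

/-- The number of `231`-avoiding permutations of length `q`. -/
noncomputable def suffixCount (q : ℕ) : ℤ :=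
  ∑ τ : Perm (Fin q), if HoleAvoids 0 τ then 1 else 0

theorem suffixCount_eq (q : ℕ) : suffixCount q = coeff q cat := by
  have h := sum_coeff_backLabel q 0
  simpa only [suffixCount, coeff_zero_cat_pow, zero_add] using h

theorem extensionSeries_zero : extensionSeries 0 = cat := by
  have h (τ : Perm (Fin 0)) : frontLabel 0 τ = 1 := by
    have := frontBound_le 0 τ
    rw [frontLabel]; omega
  simp [extensionSeries, h, HoleAvoids]

theorem extensionSeries_succ (q : ℕ) : extensionSeries (q + 1) =
    cat * extensionSeries q + (C (suffixCount (q + 1)) - C (suffixCount q)) * cat ^ 2 := by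
  have hback (τ : Perm (Fin q)) : AllowsBack τ (Fin.last q) := by
    rw [Fin.val_last]; exact allowsBack_self τ
  have hcount : suffixCount (q + 1) = suffixCount q + ∑ τ : Perm (Fin q),
      if HoleAvoids 0 τ then ∑ v : Fin q, (if AllowsBack τ v then 1 else 0) else 0 := by
    rw [suffixCount, suffixCount, sum_insertPerm (Fin.last q), ← sum_add_distrib]
    refine sum_congr rfl fun τ _ => ?_
    simp only [holeAvoids_insertPerm_last, Fin.sum_univ_castSucc, hback, and_true,
      Fin.val_castSucc]
    split_ifs with h
    · simp [h, add_comm]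
    · simp [h]
  have hser : extensionSeries (q + 1) = cat * extensionSeries q + ∑ τ : Perm (Fin q),
      if HoleAvoids 0 τ then ∑ v : Fin q, (if AllowsBack τ v then cat ^ 2 else 0) else 0 := by
    rw [extensionSeries, extensionSeries, sum_insertPerm (Fin.last q), mul_sum, ← sum_add_distrib]
    refine sum_congr rfl fun τ _ => ?_
    have h1 : frontLabel 0 (insertPerm (Fin.last q) (Fin.last q) τ) = frontLabel 0 τ + 1 := by
      have := frontBound_le 0 τ
      rw [frontLabel, frontBound_insertPerm_last_last, frontLabel]
      omega
    have h2 (v : Fin q) : (if HoleAvoids 0 τ ∧ AllowsBack τ v then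
        cat ^ frontLabel 0 (insertPerm (Fin.last q) v.castSucc τ) else 0) =
        if HoleAvoids 0 τ ∧ AllowsBack τ v then cat ^ 2 else 0 := by
      split_ifs with h
      · rw [frontLabel, frontBound_insertPerm_last_of_lt v.castSucc (by simpa using h.2) (by simp)]
        congr 1
        omega
      · rfl
    simp only [holeAvoids_insertPerm_last, Fin.sum_univ_castSucc, hback, and_true,
      Fin.val_castSucc, h1, h2]
    split_ifs with h
    · simp only [h, true_and]
      ring
    · simp [h]
  rw [hser, hcount, map_add, add_sub_cancel_left, map_sum, sum_mul]
  congr 1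
  refine sum_congr rfl fun τ _ => ?_
  split_ifs with h
  · rw [map_sum, sum_mul]
    refine sum_congr rfl fun v _ => ?_
    split_ifs <;> simp
  · simp

/-- The number of pairs of a permutation of length `m` and a place for the hole that satisfy
`HoleAvoids`. -/
theorem sum_card_holeAvoids (m : ℕ) :
    ∑ p ∈ range (m + 1), (Fintype.card {τ : Perm (Fin m) // HoleAvoids p τ} : ℤ) =
      ((2 * m).choose m : ℤ) - if 4 ≤ m then ((2 * m).choose (m - 4) : ℤ) else 0 := by
  rw [← coeff_cat_sq_add, ← sum_coeff_of_recursion extensionSeries suffixCount suffixCount_eq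
    extensionSeries_zero extensionSeries_succ, ← sum_range_reflect]
  refine sum_congr rfl fun q hq => ?_
  have hq' : q ≤ m := by simpa [Nat.lt_succ_iff] using hq
  obtain ⟨p, rfl⟩ := Nat.exists_eq_add_of_le hq'
  have h := sum_coeff_frontLabel q p 0
  simp only [coeff_zero_cat_pow, zero_add] at h
  rw [show q + p + 1 - 1 - q = p by omega, show q + p - q = p by omega, extensionSeries, map_sum,
    Fintype.card_subtype, card_filter]
  push_cast
  rw [h]
  refine sum_congr rfl fun τ _ => ?_
  split_ifs <;> simp

end Counting

/-! ### Standardization and occurrences of `1342` -/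

section Standardization

theorem st_lt_st_iff {ι α : Type*} [Fintype ι] [LinearOrder α] (w : ι → α) (a b : ι) :
    st w a < st w b ↔ w a < w b := by
  constructor
  · contrapose!
    intro h
    exact card_le_card fun j hj => by
      simp only [mem_filter, mem_univ, true_and] at hj ⊢
      exact hj.trans_le h
  · intro h
    refine card_lt_card (Finset.ssubset_iff_of_subset (fun j hj => ?_) |>.2 ⟨a, ?_, ?_⟩)
    · simp only [mem_filter, mem_univ, true_and] at hj ⊢
      exact hj.trans h
    · simpa using h
    · simp

theorem st_comp_equiv {ι κ α : Type*} [Fintype ι] [Fintype κ] [LinearOrder α] (e : κ ≃ ι)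
    (w : ι → α) (i : κ) : st w (e i) = st (fun j => w (e j)) i := by
  refine (card_bij (fun j _ => e j) (fun j hj => by simpa using hj) (fun _ _ _ _ h => e.injective h)
    fun j hj => ⟨e.symm j, by simpa using hj, by simp⟩).symm

theorem st_strictMono_comp_perm {l : ℕ} {α : Type*} [LinearOrder α] {u : Fin l → α}
    (hu : StrictMono u) (p : Perm (Fin l)) (a : Fin l) : st (fun b => u (p b)) a = (p a : ℕ) := by
  have h := st_comp_equiv p u a
  rw [← h, st]
  simp only [hu.lt_iff_lt]
  rw [← Fin.card_Iio]
  congr 1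
  ext
  simp

theorem permAvoids_p1342_iff {n : ℕ} (σ : Perm (Fin n)) :
    PermAvoids σ p1342 ↔ ∀ a b c d, a < b → b < c → c < d →
      ¬(σ a < σ d ∧ σ d < σ b ∧ σ b < σ c) := by
  constructor
  · intro h a b c d hab hbc hcd hh
    refine h ⟨![a, b, c, d], ?_, fun x => ?_⟩
    · rw [Fin.strictMono_iff_lt_succ]
      intro i
      fin_cases i <;> assumption
    · have hu : StrictMono fun x : Fin 4 => σ (![a, d, b, c] x) := by
        rw [Fin.strictMono_iff_lt_succ]
        intro i
        fin_cases i
        exacts [hh.1, hh.2.1, hh.2.2]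
      rw [← st_strictMono_comp_perm hu p1342 x]
      congr 1
      funext y
      fin_cases y <;> rfl
  · rintro h ⟨f, hf, hst⟩
    have hlt (x y : Fin 4) (hxy : p1342 x < p1342 y) : σ (f x) < σ (f y) := by
      rw [← st_lt_st_iff (fun b => σ (f b)) x y, hst, hst]
      exact hxy
    exact h (f 0) (f 1) (f 2) (f 3) (hf (by decide)) (hf (by decide)) (hf (by decide))
      ⟨hlt _ _ (by decide), hlt _ _ (by decide), hlt _ _ (by decide)⟩

end Standardization

/-! ### Partial permutations with one hole -/

section Hole

variable {n : ℕ}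

theorem forall_permAvoids_insertPerm_iff (p : Fin (n + 1)) (τ : Perm (Fin n)) :
    (∀ v, PermAvoids (insertPerm p v τ) p1342) ↔ HoleAvoids p τ := by
  simp only [permAvoids_p1342_iff]
  constructor
  · intro h i j k hij hjk
    have hij' := Fin.succAbove_lt_succAbove_iff (p := p) |>.2 hij
    have hjk' := Fin.succAbove_lt_succAbove_iff (p := p) |>.2 hjk
    refine ⟨fun hk hh => ?_, fun hi hh => ?_, fun hi hk hh => ?_⟩
    · -- the filling is the `2` of `1342`, placed directly above the `1`
      refine h (τ i).succ _ _ _ _ hij' hjk' ((succAbove_lt_iff_val p k).2 hk) ?_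
      simp only [insertPerm_self, insertPerm_succAbove, succAbove_lt_iff_val,
        lt_succAbove_iff_val, Fin.succAbove_lt_succAbove_iff, Fin.val_succ]
      exact ⟨by omega, Fin.lt_def.1 hh.1, hh.2⟩
    · -- the filling is the `1` of `1342`
      refine h 0 _ _ _ _ ((lt_succAbove_iff_val p i).2 hi) hij' hjk' ?_
      simp only [insertPerm_self, insertPerm_succAbove,
        lt_succAbove_iff_val, Fin.succAbove_lt_succAbove_iff, Fin.val_zero]
      exact ⟨Nat.zero_le _, hh⟩
    · by_cases hj : (j : ℕ) < p
      · -- the filling is the `4` of `1342`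
        refine h (Fin.last n) _ _ _ _ hij' ((succAbove_lt_iff_val p j).2 hj)
          ((lt_succAbove_iff_val p k).2 hk) ?_
        simp only [insertPerm_self, insertPerm_succAbove, succAbove_lt_iff_val,
          Fin.succAbove_lt_succAbove_iff, Fin.val_last]
        exact ⟨hh.1, hh.2, (τ j).isLt⟩
      · -- the filling is the `3` of `1342`, placed directly above the `2`
        refine h (τ k).succ _ _ _ _ ((succAbove_lt_iff_val p i).2 hi)
          ((lt_succAbove_iff_val p j).2 (not_lt.1 hj)) hjk' ?_
        simp only [insertPerm_self, insertPerm_succAbove, succAbove_lt_iff_val,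
          lt_succAbove_iff_val, Fin.succAbove_lt_succAbove_iff, Fin.val_succ]
        exact ⟨hh.1, by omega, Fin.lt_def.1 hh.2⟩
  · intro h v a b c d hab hbc hcd hh
    have hcase (x : Fin (n + 1)) : x = p ∨ ∃ i, x = p.succAbove i := Fin.eq_self_or_eq_succAbove p x
    rcases hcase a with ha | ⟨i, rfl⟩
    · obtain ⟨j, rfl⟩ := (hcase b).resolve_left fun hb => hab.ne (ha.trans hb.symm)
      obtain ⟨k, rfl⟩ := (hcase c).resolve_left fun hc => (hab.trans hbc).ne (ha.trans hc.symm)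
      obtain ⟨l, rfl⟩ := (hcase d).resolve_left fun hd =>
        ((hab.trans hbc).trans hcd).ne (ha.trans hd.symm)
      rw [ha, lt_succAbove_iff_val] at hab
      simp only [insertPerm_succAbove, Fin.succAbove_lt_succAbove_iff] at hbc hcd hh
      exact (h j k l hbc hcd).2.1 hab hh.2
    rcases hcase b with hb | ⟨j, rfl⟩
    · obtain ⟨k, rfl⟩ := (hcase c).resolve_left fun hc => hbc.ne (hb.trans hc.symm)
      obtain ⟨l, rfl⟩ := (hcase d).resolve_left fun hd => (hbc.trans hcd).ne (hb.trans hd.symm)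
      have hik := Fin.succAbove_lt_succAbove_iff.1 (hab.trans hbc)
      rw [hb, succAbove_lt_iff_val] at hab
      rw [hb, lt_succAbove_iff_val] at hbc
      have hlk := hh.2.1.trans hh.2.2
      simp only [insertPerm_succAbove, Fin.succAbove_lt_succAbove_iff] at hcd hh hlk
      exact (h i k l hik hcd).2.2 hab (hbc.trans hcd.le) ⟨hh.1, hlk⟩
    rcases hcase c with hc | ⟨k, rfl⟩
    · obtain ⟨l, rfl⟩ := (hcase d).resolve_left fun hd => hcd.ne (hc.trans hd.symm)
      have hjl := Fin.succAbove_lt_succAbove_iff.1 (hbc.trans hcd)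
      rw [hc, succAbove_lt_iff_val] at hbc
      rw [hc, lt_succAbove_iff_val] at hcd
      simp only [insertPerm_succAbove, Fin.succAbove_lt_succAbove_iff] at hab hh
      exact (h i j l hab hjl).2.2 (lt_trans hab hbc) hcd ⟨hh.1, hh.2.1⟩
    rcases hcase d with hd | ⟨l, rfl⟩
    · rw [hd, succAbove_lt_iff_val] at hcd
      have hij := hh.1.trans hh.2.1
      simp only [insertPerm_succAbove, Fin.succAbove_lt_succAbove_iff] at hab hbc hh hij
      exact (h i j k hab hbc).1 hcd ⟨hij, hh.2.2⟩
    -- the hole is not involved, so one of the four entries is redundant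
    simp only [insertPerm_succAbove, Fin.succAbove_lt_succAbove_iff] at hab hbc hcd hh
    obtain ⟨hil, hlj, hjk⟩ := hh
    rcases le_or_gt (p : ℕ) j with hj | hj
    · exact (h j k l hbc hcd).2.1 hj ⟨hlj, hjk⟩
    rcases lt_or_ge (k : ℕ) p with hk | hk
    · exact (h i j k hab hbc).1 hk ⟨hil.trans hlj, hjk⟩
    · exact (h i j l hab (hbc.trans hcd)).2.2 (lt_trans hab hj) (hk.trans hcd.le) ⟨hil, hlj⟩

/-- The partial permutation with its only hole at position `p` and the remaining entries given
by `τ`. -/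
def holePerm (p : Fin (n + 1)) (τ : Perm (Fin n)) : Fin (n + 1) → Option (Fin n) := fun i =>
  optionCongr τ (finSuccEquiv' p i)

@[simp]
theorem holePerm_self (p : Fin (n + 1)) (τ : Perm (Fin n)) : holePerm p τ p = none := by
  simp [holePerm]

@[simp]
theorem holePerm_succAbove (p : Fin (n + 1)) (τ : Perm (Fin n)) (i : Fin n) :
    holePerm p τ (p.succAbove i) = some (τ i) := by
  simp [holePerm]

theorem holePerm_eq_none_iff {p : Fin (n + 1)} {τ : Perm (Fin n)} {i : Fin (n + 1)} :
    holePerm p τ i = none ↔ i = p := by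
  rcases Fin.eq_self_or_eq_succAbove p i with rfl | ⟨i, rfl⟩ <;> simp

theorem holePerm_injective :
    Function.Injective fun x : Fin (n + 1) × Perm (Fin n) => holePerm x.1 x.2 := by
  rintro ⟨p, τ⟩ ⟨p', τ'⟩ h
  simp only at h
  have hp : p = p' := by
    rw [← holePerm_eq_none_iff (τ := τ'), ← h, holePerm_self]
  subst hp
  have : τ = τ' := by
    ext1 i
    simpa using congrFun h (p.succAbove i)
  rw [this]

theorem mem_partialPerms_one_iff (π : Fin (n + 1) → Option (Fin n)) :
    π ∈ partialPerms (n + 1) 1 ↔ ∃ p τ, holePerm p τ = π := by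
  constructor
  · rintro ⟨h1, h2⟩
    have hsurj : Function.Surjective π := by
      rintro (_ | v)
      · obtain ⟨p, hp⟩ := card_pos.1 (h2.symm ▸ Nat.one_pos)
        exact ⟨p, by simpa using hp⟩
      · exact (h1 v).exists
    have hbij : Function.Bijective π := by
      rw [Fintype.bijective_iff_surjective_and_card]
      exact ⟨hsurj, by simp⟩
    obtain ⟨p, hp⟩ := hsurj none
    have hne (i : Fin n) : π (p.succAbove i) ≠ none := fun hi =>
      p.succAbove_ne i (hbij.1 (hi.trans hp.symm))
    choose f hf using fun i => Option.ne_none_iff_exists'.1 (hne i)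
    have hinj : Function.Injective f := fun i j hij => by
      refine p.succAbove_right_injective (hbij.1 ?_)
      rw [hf, hf, hij]
    refine ⟨p, Equiv.ofBijective f (Finite.injective_iff_bijective.1 hinj), funext fun i => ?_⟩
    rcases Fin.eq_self_or_eq_succAbove p i with rfl | ⟨i, rfl⟩
    · simp [hp]
    · simp [hf]
  · rintro ⟨p, τ, rfl⟩
    refine ⟨fun v => ⟨p.succAbove (τ.symm v), by simp, fun i hi => ?_⟩, ?_⟩
    · rcases Fin.eq_self_or_eq_succAbove p i with rfl | ⟨i, rfl⟩
      · simp at hi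
      · rw [holePerm_succAbove, Option.some_inj] at hi
        rw [← hi, symm_apply_apply]
    · simp [holePerm_eq_none_iff, Finset.filter_eq']

theorem isExtension_holePerm_iff (p v : Fin (n + 1)) (τ τ' : Perm (Fin n)) :
    IsExtension (holePerm p τ) (insertPerm p v τ') ↔ τ' = τ := by
  let e : Fin n ≃ {j // holePerm p τ j ≠ none} :=
    Equiv.ofBijective (fun i => ⟨p.succAbove i, by simp⟩)
      ⟨fun i j h => p.succAbove_right_injective (congrArg Subtype.val h), fun ⟨i, hi⟩ => by
        rcases Fin.eq_self_or_eq_succAbove p i with rfl | ⟨i, rfl⟩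
        · simp at hi
        · exact ⟨i, rfl⟩⟩
  have hst (i : Fin n) :
      st (fun j : {j // holePerm p τ j ≠ none} => insertPerm p v τ' j) (e i) = (τ' i : ℕ) := by
    rw [st_comp_equiv, ← st_strictMono_comp_perm (Fin.strictMono_succAbove v) τ' i]
    congr 1
    funext j
    exact insertPerm_succAbove p v τ' j
  constructor
  · intro h
    ext i
    rw [← hst i]
    exact h (e i) (τ i) (holePerm_succAbove p τ i)
  · rintro rfl i w hw
    obtain ⟨i, rfl⟩ := e.surjective i
    have hw' : some (τ' i) = some w := (holePerm_succAbove p τ' i).symm.trans hw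
    rw [hst, Option.some_inj.1 hw']

theorem avoids_holePerm_iff (p : Fin (n + 1)) (τ : Perm (Fin n)) :
    Avoids (holePerm p τ) p1342 ↔ HoleAvoids p τ := by
  rw [← forall_permAvoids_insertPerm_iff]
  constructor
  · exact fun h v => h _ ((isExtension_holePerm_iff p v τ τ).2 rfl)
  · intro h σ hσ
    obtain ⟨⟨v, τ'⟩, rfl⟩ := (insertPerm_bijective p).2 σ
    rw [(isExtension_holePerm_iff p v τ τ').1 hσ]
    exact h v

open Classical in
theorem s_one_eq_sum (n : ℕ) :
    s (n + 1) 1 p1342 =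
      ∑ p ∈ range (n + 1), Fintype.card {τ : Perm (Fin n) // HoleAvoids p τ} := by
  have himage : {π ∈ partialPerms (n + 1) 1 | Avoids π p1342} =
      (fun x : Fin (n + 1) × Perm (Fin n) => holePerm x.1 x.2) '' {x | HoleAvoids x.1 x.2} := by
    ext π
    constructor
    · rintro ⟨h1, h2⟩
      obtain ⟨p, τ, rfl⟩ := (mem_partialPerms_one_iff π).1 h1
      exact ⟨(p, τ), (avoids_holePerm_iff p τ).1 h2, rfl⟩
    · rintro ⟨⟨p, τ⟩, h, rfl⟩
      exact ⟨(mem_partialPerms_one_iff _).2 ⟨p, τ, rfl⟩, (avoids_holePerm_iff p τ).2 h⟩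
  rw [s, himage, Set.ncard_image_of_injective _ holePerm_injective, ← Nat.card_coe_set_eq,
    ← Fin.sum_univ_eq_sum_range fun p => Fintype.card {τ : Perm (Fin n) // HoleAvoids p τ},
    ← Fintype.card_sigma, ← Nat.card_eq_fintype_card]
  exact Nat.card_congr (Equiv.subtypeProdEquivSigmaSubtype
    fun (p : Fin (n + 1)) (τ : Perm (Fin n)) => HoleAvoids p τ)

end Hole

end PartialPerm

theorem theorem7p6 (n : ℕ) (hn : 1 ≤ n) :
    (PartialPerm.s n 1 PartialPerm.p1342 : ℤ) =
      PartialPerm.binom (2 * n - 2) ((n : ℤ) - 1) -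
        PartialPerm.binom (2 * n - 2) ((n : ℤ) - 5) := by
  obtain ⟨m, rfl⟩ := Nat.exists_eq_add_of_le' hn
  rw [PartialPerm.s_one_eq_sum, Nat.cast_sum, PartialPerm.sum_card_holeAvoids,
    show 2 * (m + 1) - 2 = 2 * m by omega, PartialPerm.binom, PartialPerm.binom,
    if_pos (c := (0 : ℤ) ≤ ((m + 1 : ℕ) : ℤ) - 1) (by omega),
    show ((m + 1 : ℕ) - 1 : ℤ).toNat = m by omega,
    show ((m + 1 : ℕ) - 5 : ℤ).toNat = m - 4 by omega]
  congr 1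
  exact if_congr (by omega) rfl rfl
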